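/- Let $X=(\tilde X,\mathcal O_X)$ be a supermanifold of dimension $m|n$: a Hausdorff, second countable space with a sheaf of supercommutative $\mathbb Z/2$-graded $\mathbb R$-algebras that is locally isomorphic to $(U,\,C^\infty_U\otimes\Lambda(\xi_1,\dots,\xi_n))$ with $U\subseteq\mathbb R^m$ open. Let $\mathcal J_X\subseteq\mathcal O_X$ be the ideal sheaf generated by the odd elements, and for $x\in\tilde X$ let $((\mathcal J/\mathcal J^2)_X)_x$ be the fibre at $x$ of the vector bundle whose sheaf of sections is $\mathcal J_X/\mathcal J_X^2$, that is, the quotient of the stalk $\mathcal J_{X,x}/\mathcal J_{X,x}^2$ by $\mathfrak m_x\cdot(\mathcal J_{X,x}/\mathcal J_{X,x}^2)$, where $\mathfrak m_x$ is the ideal of germs vanishing at $x$; let $((\mathcal J/\mathcal J^2)_X)_x^*$ be its dual real vector space. Let $(T_xX)_1$ be the odd part of the tangent space $T_xX$, i.e. the space of odd derivations $\mathcal O_{X,x}\to\mathbb R$ at $x$. Then the following hold. (1) For $f\in\mathcal O_{X,x}$ let $\tilde f$ denote its body, regarded again as an element of $\mathcal O_{X,x}$ by means of an even algebra splitting of $\mathcal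 O_{X,x}\to\mathcal O_{X,x}/\mathcal J_{X,x}$. Such splittings exist, and the map $$i_x:((\mathcal J/\mathcal J^2)_X)_x^*\to(T_xX)_1,\qquad i_x(\varphi)(f)=\varphi\big((f-\tilde f)+\mathcal J_X^2\big),$$ is well defined, does not depend on the splitting, and is an isomorphism of real vector spaces. (2) Let $H:X\to Y$ be a morphism of supermanifolds (of arbitrary dimensions), i.e. a continuous map $\tilde H:\tilde X\to\tilde Y$ with a homomorphism $H^*:\mathcal O_Y\to\tilde H_*\mathcal O_X$ of sheaves of $\mathbb Z/2$-graded $\mathbb R$-algebras. Let $x\in\tilde X$ and $y=\tilde H(x)$, let $(dH)_1:(T_xX)_1\to(T_yY)_1$ be the odd part of the differential $dH_x:v\mapsto v\circ H^*$, and let $(\bar H^*)^*:((\mathcal J/\mathcal J^2)_X)_x^*\to((\mathcal J/\mathcal J^2)_Y)_y^*$ be the dual of the map of fibres $\bar H^*:((\mathcal J/\mathcal J^2)_Y)_y\to((\mathcal J/\mathcal J^2)_X)_x$ induced by $H^*$. Then $$(dH)_1\circ i_x=i_y\circ(\bar H^*)^*.$$ -/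

import Mathlib

open CategoryTheory TopologicalSpace
open scoped Manifold ContDiff TensorProduct

universe u

noncomputable section

namespace SuperGeometry

/-! ### Superdomains -/

/-- The real vector space `ℝᵐ`. -/
abbrev RSpace (m : ℕ) : Type := EuclideanSpace ℝ (Fin m)

/-- Smooth real functions on an open subset `V` of `ℝᵐ`. -/
abbrev SmoothFun {m : ℕ} (V : Opens (RSpace m)) : Type :=
  C^∞⟮𝓘(ℝ, RSpace m), V; 𝓘(ℝ, ℝ), ℝ⟯

/-- Restriction of smooth functions to a smaller open set. -/
def SmoothFun.res {m : ℕ} {V W : Opens (RSpace m)} (h : V ≤ W) :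
    SmoothFun W →ₐ[ℝ] SmoothFun V :=
  { ContMDiffMap.restrictRingHom 𝓘(ℝ, RSpace m) 𝓘(ℝ, ℝ) ℝ h with
    commutes' := fun _ => rfl }

/-- Evaluation of smooth functions at a point. -/
def SmoothFun.evalAt {m : ℕ} {V : Opens (RSpace m)} (p : RSpace m) (hp : p ∈ V) :
    SmoothFun V →ₐ[ℝ] ℝ where
  toFun f := f ⟨p, hp⟩
  map_one' := rfl
  map_mul' _ _ := rfl
  map_zero' := rfl
  map_add' _ _ := rfl
  commutes' _ := rfl

/-- The Grassmann algebra on `n` odd generators. -/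
abbrev Grassmann (n : ℕ) : Type := ExteriorAlgebra ℝ (Fin n → ℝ)

/-- Superfunctions on the superdomain `V^{m|n}`: `C^∞(V) ⊗ Λ(ξ₁, …, ξₙ)`. -/
abbrev SuperFun {m : ℕ} (n : ℕ) (V : Opens (RSpace m)) : Type :=
  SmoothFun V ⊗[ℝ] Grassmann n

/-- Restriction of superfunctions (it acts on the coefficients). -/
def SuperFun.res {m : ℕ} (n : ℕ) {V W : Opens (RSpace m)} (h : V ≤ W) :
    SuperFun n W →ₐ[ℝ] SuperFun n V :=
  Algebra.TensorProduct.map (SmoothFun.res h) (AlgHom.id ℝ (Grassmann n))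

/-- The even (`i = 0`) and odd (`i = 1`) superfunctions on a superdomain: the Grassmann
coefficients are of even, respectively odd, degree. -/
def SuperFun.parity {m : ℕ} (n : ℕ) (V : Opens (RSpace m)) (i : ZMod 2) :
    Submodule ℝ (SuperFun n V) :=
  LinearMap.range (LinearMap.lTensor (SmoothFun V)
    (CliffordAlgebra.evenOdd (0 : QuadraticForm ℝ (Fin n → ℝ)) i).subtype)

/-- The value of a superfunction at a point: all `ξⱼ` are set to `0`, then the smooth function that
remains is evaluated. -/
def SuperFun.evalAt {m : ℕ} (n : ℕ) {V : Opens (RSpace m)} (p : RSpace m) (hp : p ∈ V) :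
    SuperFun n V →ₐ[ℝ] ℝ :=
  Algebra.TensorProduct.lift (SmoothFun.evalAt p hp) ExteriorAlgebra.algebraMapInv
    (fun _ _ => Commute.all _ _)

theorem SuperFun.evalAt_res {m : ℕ} (n : ℕ) {V W : Opens (RSpace m)} (h : V ≤ W)
    (p : RSpace m) (hp : p ∈ V) (f : SuperFun n W) :
    SuperFun.evalAt n p hp (SuperFun.res n h f) = SuperFun.evalAt n p (h hp) f := by
  have : (SuperFun.evalAt n p hp).comp (SuperFun.res n h) = SuperFun.evalAt n p (h hp) := by
    apply Algebra.TensorProduct.ext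
    · ext a
      simp [SuperFun.evalAt, SuperFun.res]
      rfl
    · ext a
      simp [SuperFun.evalAt, SuperFun.res]
  exact DFunLike.congr_fun this f

/-- A smooth function that does not vanish at `p` is invertible near `p`. -/
theorem SmoothFun.exists_isUnit_res {m : ℕ} {V : Opens (RSpace m)} (p : RSpace m) (hp : p ∈ V)
    (a : SmoothFun V) (ha : SmoothFun.evalAt p hp a ≠ 0) :
    ∃ (W : Opens (RSpace m)) (h : W ≤ V), p ∈ W ∧ IsUnit (SmoothFun.res h a) := by
  have hc : Continuous a := a.contMDiff.continuous
  have ho : IsOpen ((↑) '' {q : V | a q ≠ 0} : Set (RSpace m)) :=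
    V.isOpen.isOpenMap_subtype_val _ (isOpen_ne_fun hc continuous_const)
  have hle : (⟨_, ho⟩ : Opens (RSpace m)) ≤ V := by
    rintro _ ⟨q, -, rfl⟩
    exact q.2
  refine ⟨⟨_, ho⟩, hle, ⟨⟨p, hp⟩, ha, rfl⟩, ?_⟩
  have hne : ∀ q, SmoothFun.res hle a q ≠ 0 := by
    rintro ⟨_, q, hq, rfl⟩
    exact hq
  refine IsUnit.of_mul_eq_one
    (⟨fun q => (SmoothFun.res hle a q)⁻¹, (SmoothFun.res hle a).contMDiff.inv₀ hne⟩ :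
      SmoothFun _) ?_
  ext q
  exact mul_inv_cancel₀ (hne q)

/-! ### Superspaces and supermanifolds -/

/-- A (real) superspace: a topological space with a sheaf of supercommutative
`ℤ/2`-graded real algebras. -/
structure SuperSpace where
  /-- the underlying topological space -/
  body : TopCat.{u}
  /-- the structure sheaf -/
  sheaf : TopCat.Sheaf (AlgCat.{u} ℝ) body
  /-- the even and the odd sections -/
  parity : ∀ U : Opens body, ZMod 2 → Submodule ℝ (sheaf.presheaf.obj (.op U))
  graded : ∀ U, GradedAlgebra (parity U)
  res_parity : ∀ {U V : Opens body} (h : U ≤ V) (i : ZMod 2), ∀ f ∈ parity V i,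
    (sheaf.presheaf.map (homOfLE h).op).hom f ∈ parity U i
  even_comm : ∀ U, ∀ f ∈ parity U 0, ∀ g, f * g = g * f
  odd_anticomm : ∀ U, ∀ f ∈ parity U 1, ∀ g ∈ parity U 1, f * g = -(g * f)

namespace SuperSpace

variable (X : SuperSpace.{u})

/-- The algebra of sections over `U`. -/
abbrev Sec (U : Opens X.body) : Type u := X.sheaf.presheaf.obj (.op U)

instance (U : Opens X.body) : GradedAlgebra (X.parity U) := X.graded U

/-- Restriction of sections. -/
def res {U V : Opens X.body} (h : U ≤ V) : X.Sec V →ₐ[ℝ] X.Sec U :=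
  (X.sheaf.presheaf.map (homOfLE h).op).hom

theorem res_self {U : Opens X.body} (f : X.Sec U) : X.res le_rfl f = f := by
  simp [res]

theorem res_res {U V W : Opens X.body} (h : U ≤ V) (h' : V ≤ W) (f : X.Sec W) :
    X.res h (X.res h' f) = X.res (h.trans h') f := by
  have : (homOfLE (h.trans h')).op = (homOfLE h').op ≫ (homOfLE h).op := rfl
  simp [res, this]

/-- The sections over an open neighbourhood of `x`. -/
abbrev NhdSec (x : X.body) (i : (OpenNhds x)ᵒᵈ) : Type u := X.Sec (OrderDual.ofDual i).1

/-- Restriction to a smaller open neighbourhood of `x`. -/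
def nhdRes (x : X.body) (i j : (OpenNhds x)ᵒᵈ) (h : i ≤ j) : X.NhdSec x i →ₐ[ℝ] X.NhdSec x j :=
  X.res (U := (OrderDual.ofDual j).1) (V := (OrderDual.ofDual i).1) h

instance (x : X.body) : Nonempty (OpenNhds x)ᵒᵈ := ⟨OrderDual.toDual ⟨⊤, by trivial⟩⟩

instance directedSystem (x : X.body) :
    DirectedSystem (X.NhdSec x) (fun i j h => X.nhdRes x i j h) where
  map_self _ f := X.res_self f
  map_map _ _ _ _ _ f := X.res_res _ _ f

/-- The stalk of the structure sheaf at `x`: the direct limit of the section algebras over the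
open neighbourhoods of `x`. -/
def Stalk (x : X.body) : Type u := DirectLimit (X.NhdSec x) (X.nhdRes x)

instance (x : X.body) : Ring (X.Stalk x) :=
  inferInstanceAs (Ring (DirectLimit (X.NhdSec x) (X.nhdRes x)))

instance (x : X.body) : Algebra ℝ (X.Stalk x) :=
  inferInstanceAs (Algebra ℝ (DirectLimit (X.NhdSec x) (X.nhdRes x)))

/-- The germ at `x` of a section over a neighbourhood of `x`. -/
def germ {x : X.body} (U : Opens X.body) (hx : x ∈ U) : X.Sec U →ₐ[ℝ] X.Stalk x where
  toFun f := Quotient.mk _ ⟨OrderDual.toDual ⟨U, hx⟩, f⟩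
  map_one' := (DirectLimit.one_def _).symm
  map_mul' _ _ := (DirectLimit.mul_def _ _ _).symm
  map_zero' := (DirectLimit.zero_def _).symm
  map_add' _ _ := (DirectLimit.add_def _ _ _).symm
  commutes' r := (DirectLimit.algebraMap_def _ r).symm

theorem germ_res {x : X.body} {U V : Opens X.body} (h : U ≤ V) (hx : x ∈ U) (f : X.Sec V) :
    X.germ U hx (X.res h f) = X.germ V (h hx) f :=
  (DirectLimit.eq_of_le (F := X.NhdSec x) (f := X.nhdRes x)
    ⟨OrderDual.toDual ⟨V, h hx⟩, f⟩ (OrderDual.toDual ⟨U, hx⟩) h).symm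

theorem exists_germ {x : X.body} (s : X.Stalk x) :
    ∃ (U : Opens X.body) (hx : x ∈ U) (f : X.Sec U), X.germ U hx f = s := by
  obtain ⟨i, f, rfl⟩ := DirectLimit.exists_eq_mk _ s
  exact ⟨_, (OrderDual.ofDual i).2, f, rfl⟩

theorem germ_eq {x : X.body} {U V : Opens X.body} {hU : x ∈ U} {hV : x ∈ V}
    {f : X.Sec U} {g : X.Sec V} (h : X.germ U hU f = X.germ V hV g) :
    ∃ (W : Opens X.body) (_ : x ∈ W) (h₁ : W ≤ U) (h₂ : W ≤ V), X.res h₁ f = X.res h₂ g := by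
  obtain ⟨k, h₁, h₂, e⟩ := Quotient.exact h
  exact ⟨_, (OrderDual.ofDual k).2, h₁, h₂, e⟩

/-- Two germs have representatives over a common neighbourhood. -/
theorem exists_germ₂ {x : X.body} (s t : X.Stalk x) :
    ∃ (U : Opens X.body) (hx : x ∈ U) (f g : X.Sec U), X.germ U hx f = s ∧ X.germ U hx g = t := by
  obtain ⟨U, hU, f, rfl⟩ := X.exists_germ s
  obtain ⟨V, hV, g, rfl⟩ := X.exists_germ t
  exact ⟨U ⊓ V, Opens.mem_inf.2 ⟨hU, hV⟩, X.res inf_le_left f, X.res inf_le_right g, X.germ_res _ _ _,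
    X.germ_res _ _ _⟩

/-- A compatible family of algebra homomorphisms on sections induces one on the stalk. -/
def stalkLift {x : X.body} {A : Type*} [Ring A] [Algebra ℝ A]
    (ψ : ∀ U : Opens X.body, x ∈ U → (X.Sec U →ₐ[ℝ] A))
    (hψ : ∀ (U V : Opens X.body) (h : U ≤ V) (hx : x ∈ U) (f : X.Sec V),
      ψ U hx (X.res h f) = ψ V (h hx) f) : X.Stalk x →ₐ[ℝ] A :=
  let F : X.Stalk x → A := DirectLimit.lift (X.nhdRes x)
    (fun i f => ψ (OrderDual.ofDual i).1 (OrderDual.ofDual i).2 f)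
    (fun _ j h f => (hψ _ _ h (OrderDual.ofDual j).2 f).symm)
  have hF : ∀ U (hx : x ∈ U) f, F (X.germ U hx f) = ψ U hx f := fun _ _ _ => rfl
  { toFun := F
    map_one' := by rw [← map_one (X.germ ⊤ (Opens.mem_top x)), hF, map_one]
    map_zero' := by rw [← map_zero (X.germ ⊤ (Opens.mem_top x)), hF, map_zero]
    map_mul' := fun s t => by
      obtain ⟨U, hx, f, g, rfl, rfl⟩ := X.exists_germ₂ s t
      rw [← map_mul, hF, hF, hF, map_mul]
    map_add' := fun s t => by
      obtain ⟨U, hx, f, g, rfl, rfl⟩ := X.exists_germ₂ s t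
      rw [← map_add, hF, hF, hF, map_add]
    commutes' := fun r => by
      rw [← AlgHom.commutes (X.germ ⊤ (Opens.mem_top x)), hF, AlgHom.commutes] }

theorem stalkLift_germ {x : X.body} {A : Type*} [Ring A] [Algebra ℝ A]
    (ψ : ∀ U : Opens X.body, x ∈ U → (X.Sec U →ₐ[ℝ] A))
    (hψ : ∀ (U V : Opens X.body) (h : U ≤ V) (hx : x ∈ U) (f : X.Sec V),
      ψ U hx (X.res h f) = ψ V (h hx) f) (U : Opens X.body) (hx : x ∈ U) (f : X.Sec U) :
    X.stalkLift ψ hψ (X.germ U hx f) = ψ U hx f := rfl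

/-- The even and the odd germs. -/
def stalkParity (x : X.body) (i : ZMod 2) : Submodule ℝ (X.Stalk x) where
  carrier := {s | ∃ (U : Opens X.body) (hx : x ∈ U), ∃ f ∈ X.parity U i, X.germ U hx f = s}
  zero_mem' := ⟨⊤, Opens.mem_top x, 0, zero_mem _, map_zero _⟩
  add_mem' := by
    rintro _ _ ⟨U, hU, f, hf, rfl⟩ ⟨V, hV, g, hg, rfl⟩
    refine ⟨U ⊓ V, Opens.mem_inf.2 ⟨hU, hV⟩, X.res inf_le_left f + X.res inf_le_right g,
      add_mem (X.res_parity _ _ _ hf) (X.res_parity _ _ _ hg), ?_⟩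
    rw [map_add, X.germ_res, X.germ_res]
  smul_mem' := by
    rintro c _ ⟨U, hU, f, hf, rfl⟩
    exact ⟨U, hU, c • f, Submodule.smul_mem _ _ hf, map_smul _ _ _⟩

/-- The open set of points `x` of the source of `e` with `e x ∈ V`. -/
def preOpen {m : ℕ} (e : OpenPartialHomeomorph X.body (RSpace m)) (V : Opens (RSpace m)) :
    Opens X.body :=
  ⟨e.source ∩ e ⁻¹' V, e.isOpen_inter_preimage V.isOpen⟩

variable {X} in
theorem preOpen_mono {m : ℕ} (e : OpenPartialHomeomorph X.body (RSpace m))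
    {V W : Opens (RSpace m)} (h : V ≤ W) : X.preOpen e V ≤ X.preOpen e W :=
  fun _ hx => ⟨hx.1, h hx.2⟩

/-- A chart with values in a superdomain of dimension `m|n`: a homeomorphism `e` from an open subset
of the body onto an open subset of `ℝᵐ`, with an isomorphism of sheaves of graded algebras
between the structure sheaf over the source and the superfunctions on the target. -/
structure Chart (m n : ℕ) where
  /-- the underlying local homeomorphism -/
  e : OpenPartialHomeomorph X.body (RSpace m)
  /-- the isomorphism of structure sheaves -/
  iso : ∀ V : Opens (RSpace m), (V : Set (RSpace m)) ⊆ e.target →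
    (X.Sec (X.preOpen e V) ≃ₐ[ℝ] SuperFun n V)
  iso_res : ∀ (V W : Opens (RSpace m)) (hW : (W : Set (RSpace m)) ⊆ e.target) (h : V ≤ W)
    (f : X.Sec (X.preOpen e W)),
    iso V (Set.Subset.trans h hW) (X.res (preOpen_mono e h) f) =
      SuperFun.res n h (iso W hW f)
  iso_parity : ∀ (V : Opens (RSpace m)) (hV : (V : Set (RSpace m)) ⊆ e.target) (i : ZMod 2)
    (f : X.Sec (X.preOpen e V)),
    f ∈ X.parity _ i ↔ iso V hV f ∈ SuperFun.parity n V i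

end SuperSpace

/-- A supermanifold of dimension `m|n`: a superspace with Hausdorff, second countable body which is
locally isomorphic to superdomains of dimension `m|n`. -/
structure Supermanifold (m n : ℕ) extends SuperSpace.{u} where
  t2 : T2Space body
  secondCountable : SecondCountableTopology body
  exists_chart : ∀ x : body, ∃ c : toSuperSpace.Chart m n, x ∈ c.e.source

/-- A morphism of superspaces: a continuous map `base` and a homomorphism
`𝒪_Y → base_* 𝒪_X` of sheaves of graded algebras. -/
structure Morphism (X Y : SuperSpace.{u}) where
  base : C(X.body, Y.body)
  pullback : ∀ V : Opens Y.body, Y.Sec V →ₐ[ℝ] X.Sec (V.comap base)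
  pullback_res : ∀ {U V : Opens Y.body} (h : U ≤ V) (f : Y.Sec V),
    pullback U (Y.res h f) = X.res (Opens.comap_mono base h) (pullback V f)
  pullback_parity : ∀ (V : Opens Y.body) (i : ZMod 2), ∀ f ∈ Y.parity V i,
    pullback V f ∈ X.parity _ i

/-! ### Values of germs -/

/-- Any real-valued character of superfunctions on `V` that extends to characters on all smaller
neighbourhoods of `p` is evaluation at `p`. -/
theorem SuperFun.eq_evalAt {m n : ℕ} {V : Opens (RSpace m)} (p : RSpace m) (hp : p ∈ V)
    (θ : SuperFun n V →ₐ[ℝ] ℝ)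
    (hθ : ∀ (W : Opens (RSpace m)) (h : W ≤ V), p ∈ W →
      ∃ θ' : SuperFun n W →ₐ[ℝ] ℝ, ∀ f, θ' (SuperFun.res n h f) = θ f) :
    θ = SuperFun.evalAt n p hp := by
  have key : ∀ a : SmoothFun V, SmoothFun.evalAt p hp a ≠ 0 → θ (a ⊗ₜ 1) ≠ 0 := by
    intro a ha
    obtain ⟨W, h, hpW, hu⟩ := SmoothFun.exists_isUnit_res p hp a ha
    obtain ⟨θ', h'⟩ := hθ W h hpW
    rw [← h']
    have : SuperFun.res n h (a ⊗ₜ 1) =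
        (Algebra.TensorProduct.includeLeft : SmoothFun W →ₐ[ℝ] SuperFun n W)
          (SmoothFun.res h a) := by
      simp [SuperFun.res]
    rw [this]
    exact ((hu.map _).map θ').ne_zero
  apply Algebra.TensorProduct.ext
  · ext a
    have h0 : SmoothFun.evalAt p hp (a - algebraMap ℝ _ (θ (a ⊗ₜ 1))) = 0 := by
      by_contra hne
      refine key _ hne ?_
      rw [TensorProduct.sub_tmul, map_sub, sub_eq_zero]
      exact ((θ.comp Algebra.TensorProduct.includeLeft).commutes _).symm
    rw [map_sub, AlgHom.commutes, sub_eq_zero] at h0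
    simpa [SuperFun.evalAt] using h0.symm
  · apply ExteriorAlgebra.hom_ext
    ext i
    have hsq : ∀ v : Fin n → ℝ, θ ((1 : SmoothFun V) ⊗ₜ ExteriorAlgebra.ι ℝ v) = 0 := by
      intro v
      have : θ ((1 : SmoothFun V) ⊗ₜ ExteriorAlgebra.ι ℝ v) *
          θ ((1 : SmoothFun V) ⊗ₜ ExteriorAlgebra.ι ℝ v) = 0 := by
        rw [← map_mul, Algebra.TensorProduct.tmul_mul_tmul]
        simp
      exact mul_self_eq_zero.1 this
    simp [SuperFun.evalAt, hsq, ExteriorAlgebra.algebraMapInv]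

/-- A real linear map which vanishes on an `R`-submodule factors through the quotient. -/
def liftQuotient {R M W : Type*} [Ring R] [Algebra ℝ R] [AddCommGroup M] [Module R M] [Module ℝ M]
    [IsScalarTower ℝ R M] [AddCommGroup W] [Module ℝ W] (N : Submodule R M) (l : M →ₗ[ℝ] W)
    (h : ∀ m ∈ N, l m = 0) : (M ⧸ N) →ₗ[ℝ] W :=
  (Submodule.liftQ (N.restrictScalars ℝ) l h).comp
    (Submodule.Quotient.restrictScalarsEquiv ℝ N).symm.toLinearMap

namespace Supermanifold

variable {m n : ℕ} (X : Supermanifold.{u} m n)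

/-- In a chart, a germ at `x` can be evaluated at `x`, so there is a homomorphism of real algebras from
the stalk at `x` to `ℝ`. -/
theorem nonempty_eval (x : X.body) : Nonempty (X.Stalk x →ₐ[ℝ] ℝ) := by
  obtain ⟨c, hc⟩ := X.exists_chart x
  let T (U : Opens X.body) : Opens (RSpace m) :=
    ⟨c.e.target ∩ c.e.symm ⁻¹' U, c.e.isOpen_inter_preimage_symm U.isOpen⟩
  have hT : ∀ U, (T U : Set (RSpace m)) ⊆ c.e.target := fun _ => Set.inter_subset_left
  have hle : ∀ U, X.preOpen c.e (T U) ≤ U := by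
    rintro U y ⟨hy, -, hy'⟩
    simpa [c.e.left_inv hy] using hy'
  have hmem : ∀ U, x ∈ U → c.e x ∈ T U := fun U hU =>
    ⟨c.e.map_source hc, by simpa [c.e.left_inv hc] using hU⟩
  have hmono : ∀ U V, U ≤ V → T U ≤ T V := fun U V h q hq => ⟨hq.1, h hq.2⟩
  refine ⟨X.stalkLift (fun U hx => (SuperFun.evalAt n (c.e x) (hmem U hx)).comp
    (((c.iso (T U) (hT U)) : _ →ₐ[ℝ] _).comp (X.res (hle U)))) ?_⟩
  intro U V h hx f
  simp only [AlgHom.comp_apply, AlgEquiv.coe_toAlgHom]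
  rw [X.res_res, ← SuperFun.evalAt_res n (hmono U V h) (c.e x) (hmem U hx), ← c.iso_res, X.res_res]

/-- There is only one homomorphism of real algebras from the stalk at `x` to `ℝ`. -/
theorem subsingleton_eval (x : X.body) : Subsingleton (X.Stalk x →ₐ[ℝ] ℝ) := by
  obtain ⟨c, hc⟩ := X.exists_chart x
  have hmem : ∀ V : Opens (RSpace m), c.e x ∈ V → x ∈ X.preOpen c.e V := fun V hV => ⟨hc, hV⟩
  have main : ∀ (ψ : X.Stalk x →ₐ[ℝ] ℝ) (V : Opens (RSpace m))
      (hV : (V : Set (RSpace m)) ⊆ c.e.target) (hx : c.e x ∈ V) (f : X.Sec (X.preOpen c.e V)),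
      ψ (X.germ _ (hmem V hx) f) = SuperFun.evalAt n (c.e x) hx (c.iso V hV f) := by
    intro ψ V hV hx f
    have := SuperFun.eq_evalAt (n := n) (c.e x) hx
      ((ψ.comp (X.germ _ (hmem V hx))).comp ((c.iso V hV).symm : _ →ₐ[ℝ] _)) (by
        intro W h hxW
        refine ⟨(ψ.comp (X.germ _ (hmem W hxW))).comp
          ((c.iso W (Set.Subset.trans h hV)).symm : _ →ₐ[ℝ] _), fun g => ?_⟩
        obtain ⟨g, rfl⟩ := (c.iso V hV).surjective g
        rw [← c.iso_res]
        simp [X.germ_res])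
    rw [← this]
    simp
  refine ⟨fun ψ₁ ψ₂ => AlgHom.ext fun s => ?_⟩
  obtain ⟨U, hU, f, rfl⟩ := X.exists_germ s
  let V : Opens (RSpace m) :=
    ⟨c.e.target ∩ c.e.symm ⁻¹' U, c.e.isOpen_inter_preimage_symm U.isOpen⟩
  have hV : (V : Set (RSpace m)) ⊆ c.e.target := Set.inter_subset_left
  have hle : X.preOpen c.e V ≤ U := by
    rintro y ⟨hy, -, hy'⟩
    simpa [c.e.left_inv hy] using hy'
  have hx : c.e x ∈ V := ⟨c.e.map_source hc, by simpa [c.e.left_inv hc] using hU⟩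
  rw [← X.germ_res hle (hmem V hx), main ψ₁ V hV hx, main ψ₂ V hV hx]

/-- The value `f(x)` of a germ `f` at `x`, i.e. the unique homomorphism of real algebras from the
stalk at `x` to `ℝ`. -/
def eval (x : X.body) : X.Stalk x →ₐ[ℝ] ℝ := (X.nonempty_eval x).some

/-- The ideal of germs at `x` which vanish at `x`. -/
def maxIdeal (x : X.body) : Ideal (X.Stalk x) := RingHom.ker (X.eval x)

/-- The stalk `𝒥ₓ` of the ideal sheaf generated by the odd superfunctions. -/
def oddIdeal (x : X.body) : Ideal (X.Stalk x) := Ideal.span (X.stalkParity x 1 : Set (X.Stalk x))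

/-- The stalk `𝒥ₓ / 𝒥ₓ²` of the sheaf `𝒥 / 𝒥²`. -/
abbrev ConormalStalk (x : X.body) : Type u :=
  X.oddIdeal x ⧸ Submodule.comap (X.oddIdeal x).subtype (X.oddIdeal x * X.oddIdeal x)

/-- The fibre at `x` of the vector bundle whose sheaf of sections is `𝒥 / 𝒥²`: the quotient of the
stalk `𝒥ₓ / 𝒥ₓ²` by the multiples of germs that vanish at `x`. -/
abbrev Fibre (x : X.body) : Type u :=
  X.ConormalStalk x ⧸ (X.maxIdeal x • ⊤ : Submodule (X.Stalk x) (X.ConormalStalk x))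

/-- The class in the fibre at `x` of a germ in `𝒥ₓ`. -/
def fibreClass (x : X.body) : X.oddIdeal x →ₗ[ℝ] X.Fibre x :=
  ((Submodule.mkQ (X.maxIdeal x • ⊤ : Submodule (X.Stalk x) (X.ConormalStalk x))).comp
    (Submodule.mkQ (Submodule.comap (X.oddIdeal x).subtype
      (X.oddIdeal x * X.oddIdeal x)))).restrictScalars ℝ

/-- A linear map on `𝒥ₓ` that vanishes on `𝒥ₓ²` and on multiples of germs vanishing at `x` factors
through the fibre. -/
def fibreLift {x : X.body} {W : Type*} [AddCommGroup W] [Module ℝ W] (l : X.oddIdeal x →ₗ[ℝ] W)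
    (h₁ : ∀ j : X.oddIdeal x, (j : X.Stalk x) ∈ X.oddIdeal x * X.oddIdeal x → l j = 0)
    (h₂ : ∀ a ∈ X.maxIdeal x, ∀ j : X.oddIdeal x, l (a • j) = 0) : X.Fibre x →ₗ[ℝ] W :=
  liftQuotient _ (liftQuotient _ l h₁) (by
    intro c hc
    refine Submodule.smul_induction_on
      (p := fun c => liftQuotient (Submodule.comap (X.oddIdeal x).subtype
        (X.oddIdeal x * X.oddIdeal x)) l h₁ c = 0) hc ?_ ?_
    · intro a ha c _
      obtain ⟨j, rfl⟩ := Submodule.Quotient.mk_surjective _ c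
      exact h₂ a ha j
    · intro c d hc hd
      rw [map_add, hc, hd, add_zero])

theorem fibreLift_fibreClass {x : X.body} {W : Type*} [AddCommGroup W] [Module ℝ W]
    (l : X.oddIdeal x →ₗ[ℝ] W)
    (h₁ : ∀ j : X.oddIdeal x, (j : X.Stalk x) ∈ X.oddIdeal x * X.oddIdeal x → l j = 0)
    (h₂ : ∀ a ∈ X.maxIdeal x, ∀ j : X.oddIdeal x, l (a • j) = 0) (j : X.oddIdeal x) :
    X.fibreLift l h₁ h₂ (X.fibreClass x j) = l j := rfl

theorem fibreClass_eq_zero_of_mem_sq {x : X.body} (j : X.oddIdeal x)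
    (hj : (j : X.Stalk x) ∈ X.oddIdeal x * X.oddIdeal x) : X.fibreClass x j = 0 := by
  have : (Submodule.Quotient.mk j : X.ConormalStalk x) = 0 :=
    (Submodule.Quotient.mk_eq_zero _).2 hj
  change Submodule.Quotient.mk (Submodule.Quotient.mk j) = (0 : X.Fibre x)
  rw [this]
  rfl

theorem fibreClass_smul_eq_zero {x : X.body} {a : X.Stalk x} (ha : a ∈ X.maxIdeal x)
    (j : X.oddIdeal x) : X.fibreClass x (a • j) = 0 :=
  (Submodule.Quotient.mk_eq_zero _).2
    (Submodule.smul_mem_smul ha (Submodule.mem_top (x := Submodule.Quotient.mk j)))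

/-- The class of `a • j` is `a(x)` times the class of `j`. -/
theorem fibreClass_smul {x : X.body} (a : X.Stalk x) (j : X.oddIdeal x) :
    X.fibreClass x (a • j) = X.eval x a • X.fibreClass x j := by
  have h : a - algebraMap ℝ _ (X.eval x a) ∈ X.maxIdeal x := by
    rw [maxIdeal, RingHom.mem_ker, map_sub, AlgHom.commutes]
    simp
  have := X.fibreClass_smul_eq_zero h j
  rw [sub_smul, map_sub, sub_eq_zero, algebraMap_smul,
    LinearMap.map_smul] at this
  exact this

theorem odd_mem_oddIdeal {x : X.body} {s : X.Stalk x} (hs : s ∈ X.stalkParity x 1) :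
    s ∈ X.oddIdeal x := Ideal.subset_span hs

end Supermanifold

namespace SuperSpace

variable (X : SuperSpace.{u})

theorem stalkParity_mul {x : X.body} {i j : ZMod 2} {s t : X.Stalk x}
    (hs : s ∈ X.stalkParity x i) (ht : t ∈ X.stalkParity x j) :
    s * t ∈ X.stalkParity x (i + j) := by
  obtain ⟨U, hU, f, hf, rfl⟩ := hs
  obtain ⟨V, hV, g, hg, rfl⟩ := ht
  refine ⟨U ⊓ V, Opens.mem_inf.2 ⟨hU, hV⟩, X.res inf_le_left f * X.res inf_le_right g,
    SetLike.mul_mem_graded (X.res_parity _ _ _ hf) (X.res_parity _ _ _ hg), ?_⟩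
  rw [map_mul, X.germ_res, X.germ_res]

/-- Every germ is the sum of an even and an odd germ. -/
theorem exists_even_add_odd {x : X.body} (s : X.Stalk x) :
    ∃ a ∈ X.stalkParity x 0, ∃ b ∈ X.stalkParity x 1, a + b = s := by
  obtain ⟨U, hU, f, rfl⟩ := X.exists_germ s
  refine ⟨X.germ U hU (DirectSum.decompose (X.parity U) f 0), ⟨U, hU, _, SetLike.coe_mem _, rfl⟩,
    X.germ U hU (DirectSum.decompose (X.parity U) f 1), ⟨U, hU, _, SetLike.coe_mem _, rfl⟩, ?_⟩
  classical
  rw [← map_add]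
  congr 1
  have h : ∑ i, (DirectSum.decompose (X.parity U) f i : X.Sec U) = f := by
    conv_rhs => rw [← DirectSum.sum_support_decompose (X.parity U) f]
    exact (Finset.sum_subset (Finset.subset_univ _) (fun i _ hi => by simpa using hi)).symm
  refine Eq.trans ?_ h
  exact (Fin.sum_univ_two
    (fun i : ZMod 2 => (DirectSum.decompose (X.parity U) f i : X.Sec U))).symm

/-- A germ which is both even and odd is zero. -/
theorem eq_zero_of_even_odd {x : X.body} {s : X.Stalk x} (h₀ : s ∈ X.stalkParity x 0)
    (h₁ : s ∈ X.stalkParity x 1) : s = 0 := by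
  obtain ⟨U, hU, f, hf, rfl⟩ := h₀
  obtain ⟨V, hV, g, hg, e⟩ := h₁
  obtain ⟨W, hW, hWV, hWU, e'⟩ := X.germ_eq e
  have h0 : X.res hWU f ∈ X.parity W 0 := X.res_parity hWU 0 f hf
  have h1 := X.res_parity hWV 1 g hg
  have hz : X.res hWU f = 0 := by
    have h1' : X.res hWU f ∈ X.parity W 1 := e' ▸ h1
    rw [← DirectSum.decompose_of_mem_same (X.parity W) h0,
      DirectSum.decompose_of_mem_ne (X.parity W) h1' (show (1 : ZMod 2) ≠ 0 by decide)]
  rw [← X.germ_res hWU hW, hz, map_zero]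

end SuperSpace

namespace Supermanifold

variable {m n : ℕ} (X : Supermanifold.{u} m n)

theorem eval_odd {x : X.body} {s : X.Stalk x} (hs : s ∈ X.stalkParity x 1) : X.eval x s = 0 := by
  obtain ⟨U, hU, f, hf, rfl⟩ := hs
  have h := X.odd_anticomm U f hf f hf
  have h' : X.eval x (X.germ U hU f) * X.eval x (X.germ U hU f) =
      -(X.eval x (X.germ U hU f) * X.eval x (X.germ U hU f)) := by
    rw [← map_mul, ← map_mul]
    conv_lhs => rw [h, map_neg, map_neg]
  exact mul_self_eq_zero.1 (self_eq_neg.1 h')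

theorem oddIdeal_le_maxIdeal (x : X.body) : X.oddIdeal x ≤ X.maxIdeal x :=
  Ideal.span_le.2 fun _ hs => X.eval_odd hs

/-- An even germ in `𝒥ₓ` lies in `𝒥ₓ²`. -/
theorem mem_sq_of_even {x : X.body} {s : X.Stalk x} (h₀ : s ∈ X.stalkParity x 0)
    (hs : s ∈ X.oddIdeal x) : s ∈ X.oddIdeal x * X.oddIdeal x := by
  have key : ∀ s ∈ X.oddIdeal x, ∃ j ∈ X.oddIdeal x * X.oddIdeal x, j ∈ X.stalkParity x 0 ∧
      s - j ∈ X.stalkParity x 1 := by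
    intro s hs
    refine Submodule.closure_induction (p := fun s _ => ∃ j ∈ X.oddIdeal x * X.oddIdeal x,
      j ∈ X.stalkParity x 0 ∧ s - j ∈ X.stalkParity x 1) ?_ ?_ ?_ hs
    · exact ⟨0, zero_mem _, zero_mem _, by simp⟩
    · rintro s t - - ⟨j, hj, hj0, hj1⟩ ⟨k, hk, hk0, hk1⟩
      refine ⟨j + k, add_mem hj hk, add_mem hj0 hk0, ?_⟩
      rw [add_sub_add_comm]
      exact add_mem hj1 hk1
    · intro r s hs
      obtain ⟨a, ha, b, hb, rfl⟩ := X.exists_even_add_odd r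
      refine ⟨b * s, ?_, X.stalkParity_mul hb hs, ?_⟩
      · exact Ideal.mul_mem_mul (X.odd_mem_oddIdeal hb) (X.odd_mem_oddIdeal hs)
      · have := X.stalkParity_mul ha hs
        simpa [add_mul] using this
  obtain ⟨j, hj, hj0, hj1⟩ := key s hs
  have := X.eq_zero_of_even_odd (sub_mem h₀ hj0) hj1
  rw [sub_eq_zero.1 this]
  exact hj

/-! ### The tangent space -/

/-- The tangent vectors of parity `p` at `x`: the linear maps `v : 𝒪ₓ → ℝ` of parity `p` with
`v(fg) = v(f) g(x) + (-1)^{p|f|} f(x) v(g)` for every homogeneous germ `f` of parity `|f|` and every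
germ `g`. -/
def tangentOfParity (x : X.body) (p : ZMod 2) : Submodule ℝ (Module.Dual ℝ (X.Stalk x)) where
  carrier := {v | (∀ f ∈ X.stalkParity x (p + 1), v f = 0) ∧
    ∀ i : ZMod 2, ∀ f ∈ X.stalkParity x i, ∀ g,
      v (f * g) = v f * X.eval x g + (-1) ^ (p.val * i.val) * (X.eval x f * v g)}
  zero_mem' := ⟨fun _ _ => rfl, fun _ _ _ _ => by simp⟩
  add_mem' := by
    rintro v w ⟨hv, hv'⟩ ⟨hw, hw'⟩
    refine ⟨fun f hf => by simp [hv f hf, hw f hf], fun i f hf g => ?_⟩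
    simp only [LinearMap.add_apply, hv' i f hf g, hw' i f hf g]
    ring
  smul_mem' := by
    rintro c v ⟨hv, hv'⟩
    refine ⟨fun f hf => by simp [hv f hf], fun i f hf g => ?_⟩
    simp only [LinearMap.smul_apply, hv' i f hf g, smul_eq_mul]
    ring

/-- The tangent space `TₓX = (TₓX)₀ ⊕ (TₓX)₁`. -/
def tangentSpace (x : X.body) : Submodule ℝ (Module.Dual ℝ (X.Stalk x)) :=
  X.tangentOfParity x 0 ⊔ X.tangentOfParity x 1

/-- The odd part `(TₓX)₁` of the tangent space. -/
def oddTangentSpace (x : X.body) : Submodule ℝ (X.tangentSpace x) :=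
  (X.tangentOfParity x 1).submoduleOf (X.tangentSpace x)

/-! ### The map `iₓ` -/

/-- A way to regard the body `f̃` of a germ `f` as a germ again: an algebra homomorphism
`f ↦ f̃` on the stalk which depends only on `f` modulo `𝒥ₓ`, takes even values, and has
`f - f̃ ∈ 𝒥ₓ`. (Local coordinates provide one; it amounts to a splitting of `𝒪ₓ → 𝒪ₓ / 𝒥ₓ`.) -/
structure BodyLift (x : X.body) where
  /-- the map `f ↦ f̃` -/
  tilde : X.Stalk x →ₐ[ℝ] X.Stalk x
  tilde_even : ∀ f, tilde f ∈ X.stalkParity x 0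
  sub_tilde_mem : ∀ f, f - tilde f ∈ X.oddIdeal x
  tilde_eq_zero : ∀ f ∈ X.oddIdeal x, tilde f = 0

variable {X}

/-- The map `f ↦ f - f̃` into `𝒥ₓ`. -/
def BodyLift.nilpart {x : X.body} (σ : X.BodyLift x) : X.Stalk x →ₗ[ℝ] X.oddIdeal x where
  toFun f := ⟨f - σ.tilde f, σ.sub_tilde_mem f⟩
  map_add' f g := by
    ext
    simp only [map_add, Submodule.coe_add]
    abel
  map_smul' c f := by
    ext
    simp [smul_sub]

/-- The linear map `f ↦ φ((f - f̃) + 𝒥²)` on the stalk at `x`. -/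
def iFun {x : X.body} (σ : X.BodyLift x) (φ : Module.Dual ℝ (X.Fibre x)) :
    Module.Dual ℝ (X.Stalk x) :=
  φ.comp ((X.fibreClass x).comp σ.nilpart)

theorem BodyLift.eval_tilde {x : X.body} (σ : X.BodyLift x) (f : X.Stalk x) :
    X.eval x (σ.tilde f) = X.eval x f := by
  have := X.oddIdeal_le_maxIdeal x (σ.sub_tilde_mem f)
  rw [maxIdeal, RingHom.mem_ker, map_sub, sub_eq_zero] at this
  exact this.symm

theorem BodyLift.tilde_comm {x : X.body} (σ : X.BodyLift x) (f g : X.Stalk x) :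
    σ.tilde f * g = g * σ.tilde f := by
  obtain ⟨U, hU, a, ha, e⟩ := σ.tilde_even f
  obtain ⟨V, hV, b, rfl⟩ := X.exists_germ g
  rw [← e, ← X.germ_res (inf_le_left : U ⊓ V ≤ U) (Opens.mem_inf.2 ⟨hU, hV⟩),
    ← X.germ_res (inf_le_right : U ⊓ V ≤ V) (Opens.mem_inf.2 ⟨hU, hV⟩), ← map_mul, ← map_mul]
  exact congrArg _ (X.even_comm _ _ (X.res_parity _ _ _ ha) _)

theorem iFun_even {x : X.body} (σ : X.BodyLift x) (φ : Module.Dual ℝ (X.Fibre x))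
    {f : X.Stalk x} (hf : f ∈ X.stalkParity x 0) : iFun σ φ f = 0 := by
  have : X.fibreClass x (σ.nilpart f) = 0 :=
    X.fibreClass_eq_zero_of_mem_sq _
      (X.mem_sq_of_even (sub_mem hf (σ.tilde_even f)) (σ.sub_tilde_mem f))
  simp [iFun, this]

theorem iFun_mul {x : X.body} (σ : X.BodyLift x) (φ : Module.Dual ℝ (X.Fibre x))
    (f g : X.Stalk x) : iFun σ φ (f * g) = iFun σ φ f * X.eval x g + X.eval x f * iFun σ φ g := by
  have h : σ.nilpart (f * g) = f • σ.nilpart g + σ.tilde g • σ.nilpart f := by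
    ext
    simp only [BodyLift.nilpart, LinearMap.coe_mk, AddHom.coe_mk, map_mul, Submodule.coe_add,
      SetLike.val_smul, smul_eq_mul, σ.tilde_comm g]
    noncomm_ring
  simp only [iFun, LinearMap.comp_apply, h, map_add, X.fibreClass_smul, map_smul, smul_eq_mul,
    σ.eval_tilde]
  ring

theorem iFun_mem {x : X.body} (σ : X.BodyLift x) (φ : Module.Dual ℝ (X.Fibre x)) :
    iFun σ φ ∈ X.tangentOfParity x 1 := by
  refine ⟨fun f hf => iFun_even σ φ hf, fun i f hf g => ?_⟩
  rw [iFun_mul]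
  have hi : i = 0 ∨ i = 1 := (by decide : ∀ i : ZMod 2, i = 0 ∨ i = 1) i
  rcases hi with rfl | rfl
  · simp
  · simp [X.eval_odd hf]

variable (X) in
/-- The map `iₓ : ((𝒥/𝒥²)_X)ₓ^* → (TₓX)₁`, `φ ↦ (f ↦ φ((f - f̃) + 𝒥²))`. -/
def iMap (x : X.body) (σ : X.BodyLift x) :
    Module.Dual ℝ (X.Fibre x) →ₗ[ℝ] X.oddTangentSpace x where
  toFun φ := ⟨⟨iFun σ φ, Submodule.mem_sup_right (iFun_mem σ φ)⟩, iFun_mem σ φ⟩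
  map_add' _ _ := rfl
  map_smul' _ _ := rfl

end Supermanifold

/-! ### The maps induced by a morphism -/

namespace Morphism

/-- The homomorphism `H^* : 𝒪_{Y, H(x)} → 𝒪_{X, x}` of stalks. -/
def stalkMap {X Y : SuperSpace.{u}} (H : Morphism X Y) (x : X.body) :
    Y.Stalk (H.base x) →ₐ[ℝ] X.Stalk x :=
  Y.stalkLift (fun V hV => (X.germ (V.comap H.base) hV).comp (H.pullback V)) (by
    intro U V h hx f
    simp only [AlgHom.comp_apply, H.pullback_res h]
    exact X.germ_res (Opens.comap_mono H.base h) hx _)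

theorem stalkMap_parity {X Y : SuperSpace.{u}} (H : Morphism X Y) (x : X.body) {i : ZMod 2}
    {s : Y.Stalk (H.base x)} (hs : s ∈ Y.stalkParity (H.base x) i) :
    H.stalkMap x s ∈ X.stalkParity x i := by
  obtain ⟨V, hV, f, hf, rfl⟩ := hs
  exact ⟨V.comap H.base, hV, H.pullback V f, H.pullback_parity V i f hf, rfl⟩

variable {m n p q : ℕ} {X : Supermanifold.{u} m n} {Y : Supermanifold.{u} p q}
  (H : Morphism X.toSuperSpace Y.toSuperSpace) (x : X.body)

theorem eval_stalkMap (s : Y.Stalk (H.base x)) :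
    X.eval x (H.stalkMap x s) = Y.eval (H.base x) s := by
  have := Y.subsingleton_eval (H.base x)
  exact DFunLike.congr_fun
    (Subsingleton.elim ((X.eval x).comp (H.stalkMap x)) (Y.eval (H.base x))) s

theorem stalkMap_mem_oddIdeal {s : Y.Stalk (H.base x)} (hs : s ∈ Y.oddIdeal (H.base x)) :
    H.stalkMap x s ∈ X.oddIdeal x := by
  have : Y.oddIdeal (H.base x) ≤ (X.oddIdeal x).comap (H.stalkMap x) :=
    Ideal.span_le.2 fun t ht => X.odd_mem_oddIdeal (H.stalkMap_parity x ht)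
  exact this hs

theorem stalkMap_mem_oddIdeal_sq {s : Y.Stalk (H.base x)} (hs : s ∈ Y.oddIdeal (H.base x) * Y.oddIdeal (H.base x)) :
    H.stalkMap x s ∈ X.oddIdeal x * X.oddIdeal x := by
  have : Y.oddIdeal (H.base x) * Y.oddIdeal (H.base x) ≤ (X.oddIdeal x * X.oddIdeal x).comap (H.stalkMap x) := by
    rw [Ideal.mul_le]
    intro a ha b hb
    rw [Ideal.mem_comap, map_mul]
    exact Ideal.mul_mem_mul (H.stalkMap_mem_oddIdeal x ha) (H.stalkMap_mem_oddIdeal x hb)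
  exact this hs

/-- The restriction of `H^*` to a linear map `𝒥_{Y, H(x)} → 𝒥_{X, x}`. -/
def oddIdealMap : Y.oddIdeal (H.base x) →ₗ[ℝ] X.oddIdeal x where
  toFun j := ⟨H.stalkMap x j, H.stalkMap_mem_oddIdeal x j.2⟩
  map_add' _ _ := by ext; simp
  map_smul' _ _ := by ext; simp

/-- The bundle map `H̄^* : (𝒥/𝒥²)_{Y, H(x)} → (𝒥/𝒥²)_{X, x}` induced by `H^*` on fibres. -/
def fibreMap : Y.Fibre (H.base x) →ₗ[ℝ] X.Fibre x :=
  Y.fibreLift ((X.fibreClass x).comp (H.oddIdealMap x))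
    (fun j hj => X.fibreClass_eq_zero_of_mem_sq _ (H.stalkMap_mem_oddIdeal_sq x hj))
    (fun a ha j => by
      have h : H.oddIdealMap x (a • j) = H.stalkMap x a • H.oddIdealMap x j := by
        ext
        simp [oddIdealMap]
      have ha' : H.stalkMap x a ∈ X.maxIdeal x := by
        change X.eval x (H.stalkMap x a) = 0
        rw [H.eval_stalkMap]
        exact ha
      rw [LinearMap.comp_apply, h, X.fibreClass_smul_eq_zero ha'])

/-- The dual bundle map `(H̄^*)^* : (𝒥/𝒥²)_{X, x}^* → (𝒥/𝒥²)_{Y, H(x)}^*`, `φ ↦ φ ∘ H̄^*`. -/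
def dualFibreMap : Module.Dual ℝ (X.Fibre x) →ₗ[ℝ] Module.Dual ℝ (Y.Fibre (H.base x)) :=
  (H.fibreMap x).dualMap

theorem comp_stalkMap_mem {r : ZMod 2} {v : Module.Dual ℝ (X.Stalk x)}
    (hv : v ∈ X.tangentOfParity x r) :
    (H.stalkMap x).toLinearMap.dualMap v ∈ Y.tangentOfParity (H.base x) r := by
  refine ⟨fun f hf => hv.1 _ (H.stalkMap_parity x hf), fun i f hf g => ?_⟩
  have := hv.2 i _ (H.stalkMap_parity x hf) (H.stalkMap x g)
  rw [← map_mul, H.eval_stalkMap, H.eval_stalkMap] at this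
  exact this

/-- The differential `dHₓ : TₓX → T_{H(x)}Y`, `v ↦ v ∘ H^*`. -/
def differential : X.tangentSpace x →ₗ[ℝ] Y.tangentSpace (H.base x) :=
  (H.stalkMap x).toLinearMap.dualMap.restrict (by
    intro v hv
    obtain ⟨a, ha, b, hb, rfl⟩ := Submodule.mem_sup.1 hv
    rw [map_add]
    exact Submodule.add_mem_sup (H.comp_stalkMap_mem x ha) (H.comp_stalkMap_mem x hb))

/-- The odd part `(dHₓ)₁ : (TₓX)₁ → (T_{H(x)}Y)₁` of the differential. -/
def oddDifferential : X.oddTangentSpace x →ₗ[ℝ] Y.oddTangentSpace (H.base x) :=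
  (H.differential x).restrict fun _ hv => H.comp_stalkMap_mem x hv

end Morphism

end SuperGeometry

end

/-! Existence of a splitting is local: in a chart a superfunction is an element of `C^∞(V) ⊗ Λ`, and
its body is obtained by applying the augmentation `Λ → ℝ` to the Grassmann factor. This commutes
with restriction, hence acts on germs (`stalkBody`). Its values are even, it kills odd functions,
and it changes a function only by an element of the ideal of odd functions (`sub_bodyMap_mem`).

Everything else rests on a description of `iₓ(φ)` in which the splitting does not occur. An even
germ `f` is sent to `0`: `f - f̃` is then an even element of `𝒥ₓ`, and even elements of `𝒥ₓ` lie in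
`𝒥ₓ²`. A germ `j` in `𝒥ₓ` has `j̃ = 0`, so it is sent to `φ` of its class (`iFun_coe`). Every germ
is an even one plus an odd one, and odd germs lie in `𝒥ₓ`, so these two properties determine `iₓ(φ)`
(`eq_iFun`).

Independence of the splitting is immediate. Injectivity holds because the classes of elements of
`𝒥ₓ` exhaust the fibre. For surjectivity, an odd tangent vector `v` is restricted to `𝒥ₓ`. The
Leibniz rule makes it vanish on `𝒥ₓ²` and on `𝔪ₓ𝒥ₓ`, since germs in `𝒥ₓ` vanish at `x`, so it
descends to a functional on the fibre whose image is `v`. Naturality is the same criterion applied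
to `iₓ(φ) ∘ H^*`, because `H^*` preserves parity and induces `H̄^*` on classes. -/

noncomputable section

namespace SuperGeometry

/-! ### The Grassmann algebra and its augmentation -/

/-- The augmentation kills the odd part of the Grassmann algebra. -/
theorem Grassmann.algebraMapInv_odd {n : ℕ} {w : Grassmann n}
    (hw : w ∈ CliffordAlgebra.evenOdd (0 : QuadraticForm ℝ (Fin n → ℝ)) 1) :
    ExteriorAlgebra.algebraMapInv w = 0 := by
  -- The augmentation is unchanged by the grade involution, since both composites kill the
  -- generators. On an odd element the involution is `-1`, so the augmentation there equals its own
  -- negative.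
  have h : (ExteriorAlgebra.algebraMapInv (R := ℝ) (M := Fin n → ℝ)).comp
      CliffordAlgebra.involute = ExteriorAlgebra.algebraMapInv := by
    apply ExteriorAlgebra.hom_ext
    ext i
    simp [ExteriorAlgebra.algebraMapInv, ExteriorAlgebra.ι]
  have h' := DFunLike.congr_fun h w
  rw [AlgHom.comp_apply, CliffordAlgebra.involute_eq_of_mem_odd hw, map_neg] at h'
  exact self_eq_neg.1 h'.symm

/-! ### The body of a superfunction -/

namespace SuperFun

variable {m n : ℕ}

/-- The body of a superfunction: all `ξⱼ` are set to `0`. -/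
def bodyMap (n : ℕ) (V : Opens (RSpace m)) : SuperFun n V →ₐ[ℝ] SuperFun n V :=
  Algebra.TensorProduct.map (AlgHom.id ℝ (SmoothFun V))
    ((Algebra.ofId ℝ (Grassmann n)).comp ExteriorAlgebra.algebraMapInv)

theorem bodyMap_tmul (V : Opens (RSpace m)) (a : SmoothFun V) (w : Grassmann n) :
    bodyMap n V (a ⊗ₜ w) = a ⊗ₜ algebraMap ℝ _ (ExteriorAlgebra.algebraMapInv w) := rfl

/-- Together with `coord_res` and `coordGerm_res`, this makes the body well defined on germs. -/
theorem bodyMap_res {V W : Opens (RSpace m)} (h : V ≤ W) (f : SuperFun n W) :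
    bodyMap n V (res n h f) = res n h (bodyMap n W f) := by
  induction f using TensorProduct.induction_on with
  | zero => simp
  | add f g hf hg => simp only [map_add, hf, hg]
  | tmul a w => simp [res, bodyMap_tmul]

theorem tmul_mem_parity {V : Opens (RSpace m)} {i : ZMod 2} (a : SmoothFun V) {w : Grassmann n}
    (hw : w ∈ CliffordAlgebra.evenOdd (0 : QuadraticForm ℝ (Fin n → ℝ)) i) :
    a ⊗ₜ w ∈ parity n V i :=
  ⟨a ⊗ₜ ⟨w, hw⟩, rfl⟩

/-- The Grassmann factor of a body is a real scalar, hence of degree `0`. -/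
theorem bodyMap_mem_parity {V : Opens (RSpace m)} (f : SuperFun n V) :
    bodyMap n V f ∈ parity n V 0 := by
  induction f using TensorProduct.induction_on with
  | zero => simp
  | add f g hf hg => simpa only [map_add] using add_mem hf hg
  | tmul a w =>
    rw [bodyMap_tmul]
    exact tmul_mem_parity a (SetLike.algebraMap_mem_graded _ _)

theorem bodyMap_odd {V : Opens (RSpace m)} {f : SuperFun n V} (hf : f ∈ parity n V 1) :
    bodyMap n V f = 0 := by
  obtain ⟨t, rfl⟩ := hf
  induction t using TensorProduct.induction_on with
  | zero => simp
  | add f g hf hg => simp only [map_add, hf, hg, add_zero]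
  | tmul a w =>
    rw [LinearMap.lTensor_tmul, bodyMap_tmul, Submodule.subtype_apply,
      Grassmann.algebraMapInv_odd w.2, map_zero, TensorProduct.tmul_zero]

/-- A superfunction differs from its body by an element of the ideal of odd superfunctions. -/
theorem sub_bodyMap_mem {V : Opens (RSpace m)} (f : SuperFun n V) :
    f - bodyMap n V f ∈ Ideal.span (parity n V 1 : Set (SuperFun n V)) := by
  induction f using TensorProduct.induction_on with
  | zero => simp
  | add f g hf hg =>
    rw [map_add, add_sub_add_comm]
    exact add_mem hf hg
  | tmul a w =>
    rw [bodyMap_tmul]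
    -- The coefficient `a` stays general because the product case splits off `1 ⊗ w` and leaves `a`
    -- on the other factor.
    induction w using ExteriorAlgebra.induction generalizing a with
    | algebraMap r => simp [ExteriorAlgebra.algebraMapInv]
    | ι v =>
      have h : ExteriorAlgebra.algebraMapInv (ExteriorAlgebra.ι ℝ v) = 0 := by
        simp [ExteriorAlgebra.algebraMapInv]
      rw [h, map_zero, TensorProduct.tmul_zero, sub_zero]
      exact Ideal.subset_span (tmul_mem_parity a (CliffordAlgebra.ι_mem_evenOdd_one _ v))
    | mul w w' hw hw' =>
      -- With `ε` the augmentation, this is `ww' - ε(w)ε(w') = w(w' - ε(w')) + ε(w')(w - ε(w))`. It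
      -- is arranged so that only left multiplication and real scalars act on the two differences,
      -- since `Ideal` means left ideal here.
      have h : a ⊗ₜ[ℝ] (w * w') -
          a ⊗ₜ[ℝ] algebraMap ℝ (Grassmann n) (ExteriorAlgebra.algebraMapInv (w * w')) =
          ((1 : SmoothFun V) ⊗ₜ[ℝ] w) *
            (a ⊗ₜ[ℝ] w' - a ⊗ₜ[ℝ] algebraMap ℝ (Grassmann n) (ExteriorAlgebra.algebraMapInv w')) +
          ExteriorAlgebra.algebraMapInv w' •
            (a ⊗ₜ[ℝ] w - a ⊗ₜ[ℝ] algebraMap ℝ (Grassmann n) (ExteriorAlgebra.algebraMapInv w)) := by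
        simp only [mul_sub, smul_sub, Algebra.TensorProduct.tmul_mul_tmul, one_mul, map_mul,
          ← TensorProduct.tmul_smul, Algebra.smul_def, ← Algebra.commutes
            (ExteriorAlgebra.algebraMapInv w')]
        abel
      rw [h]
      refine add_mem (Ideal.mul_mem_left _ _ (hw' a)) ?_
      exact Submodule.smul_of_tower_mem _ _ (hw a)
    | add w w' hw hw' =>
      rw [map_add, map_add, TensorProduct.tmul_add, TensorProduct.tmul_add, add_sub_add_comm]
      exact add_mem (hw a) (hw' a)

end SuperFun

/-! ### Existence of body lifts -/

namespace SuperSpace.Chart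

variable {X : SuperSpace.{u}} {m n : ℕ} (c : X.Chart m n)

/-- The part of `U` in the domain of a chart, as an open subset of `ℝᵐ`. -/
def imageOpen (U : Opens X.body) : Opens (RSpace m) :=
  ⟨c.e.target ∩ c.e.symm ⁻¹' U, c.e.isOpen_inter_preimage_symm U.isOpen⟩

theorem imageOpen_subset (U : Opens X.body) : (c.imageOpen U : Set (RSpace m)) ⊆ c.e.target :=
  Set.inter_subset_left

theorem imageOpen_mono {U V : Opens X.body} (h : U ≤ V) : c.imageOpen U ≤ c.imageOpen V :=
  fun _ hq => ⟨hq.1, h hq.2⟩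

theorem preOpen_imageOpen_le (U : Opens X.body) : X.preOpen c.e (c.imageOpen U) ≤ U := by
  rintro y ⟨hy, -, hy'⟩
  simpa [c.e.left_inv hy] using hy'

theorem mem_preOpen_imageOpen {x : X.body} (hc : x ∈ c.e.source) {U : Opens X.body} (hx : x ∈ U) :
    x ∈ X.preOpen c.e (c.imageOpen U) :=
  ⟨hc, c.e.map_source hc, by simpa [c.e.left_inv hc] using hx⟩

/-- A section over `U` in the coordinates of a chart. -/
def coord (U : Opens X.body) : X.Sec U →ₐ[ℝ] SuperFun n (c.imageOpen U) :=
  (c.iso _ (c.imageOpen_subset U) : _ →ₐ[ℝ] _).comp (X.res (c.preOpen_imageOpen_le U))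

theorem coord_res {U V : Opens X.body} (h : U ≤ V) (f : X.Sec V) :
    c.coord U (X.res h f) = SuperFun.res n (c.imageOpen_mono h) (c.coord V f) := by
  simp only [coord, AlgHom.comp_apply, AlgEquiv.coe_toAlgHom]
  rw [X.res_res, ← c.iso_res, X.res_res]

theorem coord_parity {U : Opens X.body} {i : ZMod 2} {f : X.Sec U} (hf : f ∈ X.parity U i) :
    c.coord U f ∈ SuperFun.parity n (c.imageOpen U) i :=
  (c.iso_parity _ (c.imageOpen_subset U) i _).1 (X.res_parity (c.preOpen_imageOpen_le U) i f hf)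

/-- The germ at `x` of a superfunction given in the coordinates of a chart. -/
def coordGerm {x : X.body} (hc : x ∈ c.e.source) (U : Opens X.body) (hx : x ∈ U) :
    SuperFun n (c.imageOpen U) →ₐ[ℝ] X.Stalk x :=
  (X.germ _ (c.mem_preOpen_imageOpen hc hx)).comp
    ((c.iso _ (c.imageOpen_subset U)).symm : _ →ₐ[ℝ] _)

theorem coordGerm_res {x : X.body} (hc : x ∈ c.e.source) {U V : Opens X.body} (h : U ≤ V)
    (hx : x ∈ U) (f : SuperFun n (c.imageOpen V)) :
    c.coordGerm hc U hx (SuperFun.res n (c.imageOpen_mono h) f) = c.coordGerm hc V (h hx) f := by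
  obtain ⟨g, rfl⟩ := (c.iso _ (c.imageOpen_subset V)).surjective f
  rw [← c.iso_res]
  simp only [coordGerm, AlgHom.comp_apply, AlgEquiv.coe_toAlgHom, AlgEquiv.symm_apply_apply]
  exact X.germ_res _ _ _

/-- Going to coordinates and back only shrinks the neighbourhood to the domain of the chart, which
does not affect the germ. -/
theorem coordGerm_coord {x : X.body} (hc : x ∈ c.e.source) (U : Opens X.body) (hx : x ∈ U)
    (f : X.Sec U) : c.coordGerm hc U hx (c.coord U f) = X.germ U hx f := by
  simp only [coordGerm, coord, AlgHom.comp_apply, AlgEquiv.coe_toAlgHom, AlgEquiv.symm_apply_apply]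
  exact X.germ_res _ _ _

theorem coordGerm_parity {x : X.body} (hc : x ∈ c.e.source) (U : Opens X.body) (hx : x ∈ U)
    {i : ZMod 2} {f : SuperFun n (c.imageOpen U)}
    (hf : f ∈ SuperFun.parity n (c.imageOpen U) i) :
    c.coordGerm hc U hx f ∈ X.stalkParity x i :=
  ⟨_, c.mem_preOpen_imageOpen hc hx, (c.iso _ (c.imageOpen_subset U)).symm f,
    (c.iso_parity _ (c.imageOpen_subset U) i _).2 (by simpa using hf), rfl⟩

/-- The body of a germ at `x`, in the coordinates of a chart. -/
def stalkBody {x : X.body} (hc : x ∈ c.e.source) : X.Stalk x →ₐ[ℝ] X.Stalk x :=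
  X.stalkLift (fun U hx => (c.coordGerm hc U hx).comp
    ((SuperFun.bodyMap n (c.imageOpen U)).comp (c.coord U))) (by
      intro U V h hx f
      simp only [AlgHom.comp_apply]
      rw [c.coord_res h, SuperFun.bodyMap_res, c.coordGerm_res])

theorem stalkBody_germ {x : X.body} (hc : x ∈ c.e.source) (U : Opens X.body) (hx : x ∈ U)
    (f : X.Sec U) : c.stalkBody hc (X.germ U hx f) =
      c.coordGerm hc U hx (SuperFun.bodyMap n (c.imageOpen U) (c.coord U f)) := rfl

end SuperSpace.Chart

namespace Supermanifold

variable {m n : ℕ} {X : Supermanifold.{u} m n} {x : X.body}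

/-- A chart around `x` provides a body lift at `x`. -/
def BodyLift.ofChart (c : X.Chart m n) (hc : x ∈ c.e.source) : X.BodyLift x where
  tilde := c.stalkBody hc
  tilde_even s := by
    obtain ⟨U, hx, f, rfl⟩ := X.exists_germ s
    rw [c.stalkBody_germ]
    exact c.coordGerm_parity hc U hx (SuperFun.bodyMap_mem_parity _)
  sub_tilde_mem s := by
    obtain ⟨U, hx, f, rfl⟩ := X.exists_germ s
    rw [c.stalkBody_germ, ← c.coordGerm_coord hc U hx f, ← map_sub]
    -- The difference is now the image under `coordGerm` of a superfunction minus its body. This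
    -- homomorphism sends odd superfunctions to odd germs, so it carries the one ideal into the
    -- other.
    have h : Ideal.span (SuperFun.parity n (c.imageOpen U) 1 : Set _) ≤
        (X.oddIdeal x).comap (c.coordGerm hc U hx) :=
      Ideal.span_le.2 fun g hg => X.odd_mem_oddIdeal (c.coordGerm_parity hc U hx hg)
    exact h (SuperFun.sub_bodyMap_mem _)
  tilde_eq_zero s hs := by
    -- The kernel of a homomorphism is an ideal, so only the odd generators have to be checked.
    have h : X.oddIdeal x ≤ RingHom.ker (c.stalkBody hc) := by
      refine Ideal.span_le.2 ?_
      rintro _ ⟨U, hx, f, hf, rfl⟩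
      rw [SetLike.mem_coe, RingHom.mem_ker, c.stalkBody_germ,
        SuperFun.bodyMap_odd (c.coord_parity hf), map_zero]
    exact h hs

/-! ### The map `iₓ` -/

theorem fibreClass_surjective : Function.Surjective (X.fibreClass x) :=
  (Submodule.mkQ_surjective _).comp (Submodule.mkQ_surjective _)

/-- On `𝒥ₓ` the functional `iₓ(φ)` is `φ` on classes. -/
theorem iFun_coe (σ : X.BodyLift x) (φ : Module.Dual ℝ (X.Fibre x)) (j : X.oddIdeal x) :
    iFun σ φ j = φ (X.fibreClass x j) := by
  -- The splitting kills `𝒥ₓ`, so `j - j̃ = j` and `σ` drops out.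
  have : σ.nilpart j = j := by
    ext
    simp [BodyLift.nilpart, σ.tilde_eq_zero j j.2]
  simp [iFun, this]

theorem dual_ext_of_even_odd {v w : Module.Dual ℝ (X.Stalk x)}
    (h₀ : ∀ f ∈ X.stalkParity x 0, v f = w f) (h₁ : ∀ f ∈ X.stalkParity x 1, v f = w f) :
    v = w := by
  ext s
  obtain ⟨a, ha, b, hb, rfl⟩ := X.exists_even_add_odd s
  rw [map_add, map_add, h₀ a ha, h₁ b hb]

/-- A functional which vanishes on even germs and is `φ` on classes of odd germs is `iₓ(φ)`. -/
theorem eq_iFun (σ : X.BodyLift x) (φ : Module.Dual ℝ (X.Fibre x))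
    {v : Module.Dual ℝ (X.Stalk x)} (h₀ : ∀ f ∈ X.stalkParity x 0, v f = 0)
    (h₁ : ∀ f (hf : f ∈ X.stalkParity x 1),
      v f = φ (X.fibreClass x ⟨f, X.odd_mem_oddIdeal hf⟩)) :
    v = iFun σ φ :=
  dual_ext_of_even_odd (fun f hf => by rw [h₀ f hf, iFun_even σ φ hf])
    (fun f hf => by rw [h₁ f hf, ← iFun_coe σ])

/-- `iₓ` does not depend on the splitting. -/
theorem iMap_eq_iMap (σ τ : X.BodyLift x) : X.iMap x σ = X.iMap x τ := by
  ext1 φ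
  apply Subtype.ext
  apply Subtype.ext
  exact eq_iFun τ φ (fun f hf => iFun_even σ φ hf) (fun f hf => iFun_coe σ φ ⟨f, _⟩)

/-- The values of `iₓ(φ)` on `𝒥ₓ` are those of `φ` on classes, and every element of the fibre is a
class. -/
theorem iMap_injective (σ : X.BodyLift x) : Function.Injective (X.iMap x σ) := by
  intro φ ψ h
  refine LinearMap.ext fun t => ?_
  obtain ⟨j, rfl⟩ := fibreClass_surjective t
  have h' : iFun σ φ = iFun σ ψ := congrArg Subtype.val (congrArg Subtype.val h)
  rw [← iFun_coe σ, ← iFun_coe σ, h']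

/-- The Leibniz rule for an odd tangent vector and a first factor which vanishes at `x`. -/
theorem odd_tangent_mul {v : Module.Dual ℝ (X.Stalk x)} (hv : v ∈ X.tangentOfParity x 1)
    {f : X.Stalk x} (hf : X.eval x f = 0) (g : X.Stalk x) : v (f * g) = v f * X.eval x g := by
  obtain ⟨a, ha, b, hb, rfl⟩ := X.exists_even_add_odd f
  -- Odd germs vanish at `x`, so both homogeneous parts of `f` do. The term of the Leibniz rule that
  -- carries the sign therefore disappears.
  have hb' := X.eval_odd hb
  have ha' : X.eval x a = 0 := by simpa [hb'] using hf
  rw [add_mul, map_add, hv.2 0 a ha, hv.2 1 b hb, ha', hb', map_add]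
  ring

theorem iMap_surjective (σ : X.BodyLift x) : Function.Surjective (X.iMap x σ) := by
  rintro ⟨⟨v, hv'⟩, hv⟩
  replace hv : v ∈ X.tangentOfParity x 1 := hv
  have hJ : ∀ j ∈ X.oddIdeal x, X.eval x j = 0 := fun j hj => X.oddIdeal_le_maxIdeal x hj
  have hsq : ∀ s ∈ X.oddIdeal x * X.oddIdeal x, v s = 0 := by
    intro s hs
    -- For `j, k ∈ 𝒥ₓ` both Leibniz terms of `v(jk)` contain a value at `x` of `j` or `k`, which is
    -- `0`.
    refine Submodule.mul_induction_on hs (fun j hj k hk => ?_) (fun s t hs ht => ?_)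
    · rw [odd_tangent_mul hv (hJ j hj), hJ k hk, mul_zero]
    · rw [map_add, hs, ht, add_zero]
  -- The preimage is `v` restricted to `𝒥ₓ` and passed to the fibre; `eq_iFun` identifies its image
  -- with `v`.
  refine ⟨X.fibreLift (v.comp ((X.oddIdeal x).subtype.restrictScalars ℝ)) (fun j hj => hsq _ hj)
    (fun a ha j => ?_), Subtype.ext (Subtype.ext (eq_iFun σ _ (fun f hf => ?_) fun f hf => ?_).symm)⟩
  · change v (a * j) = 0
    rw [odd_tangent_mul hv ha, hJ _ j.2, mul_zero]
  -- A vector of parity `p` kills germs of parity `p + 1`, and `1 + 1` is `0` in `ZMod 2`.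
  · exact hv.1 f hf
  · rw [fibreLift_fibreClass]
    rfl

end Supermanifold

/-! ### Naturality -/

/-- The maps `iₓ` are natural: `(dH)₁ ∘ iₓ = i_y ∘ (H̄^*)^*`. -/
theorem Morphism.oddDifferential_comp_iMap {m n p q : ℕ} {X : Supermanifold.{u} m n}
    {Y : Supermanifold.{u} p q} (H : Morphism X.toSuperSpace Y.toSuperSpace) (x : X.body)
    (σ : X.BodyLift x) (τ : Y.BodyLift (H.base x)) :
    (H.oddDifferential x).comp (X.iMap x σ) = (Y.iMap (H.base x) τ).comp (H.dualFibreMap x) := by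
  ext1 φ
  apply Subtype.ext
  apply Subtype.ext
  -- The criterion puts no condition on `τ`, so the two splittings need not be compatible with `H`.
  -- That `H̄^*` of a class is the class of the pullback holds by definition.
  exact Supermanifold.eq_iFun τ (H.dualFibreMap x φ)
    (fun f hf => Supermanifold.iFun_even σ φ (H.stalkMap_parity x hf))
    (fun f hf => Supermanifold.iFun_coe σ φ (H.oddIdealMap x ⟨f, Y.odd_mem_oddIdeal hf⟩))

end SuperGeometry

end

theorem proposition5p9p0 :
    (∀ (m n : ℕ) (X : SuperGeometry.Supermanifold.{u} m n) (x : X.body),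
      Nonempty (X.BodyLift x) ∧
      (∀ σ τ : X.BodyLift x, X.iMap x σ = X.iMap x τ) ∧
      ∀ σ : X.BodyLift x, Function.Bijective (X.iMap x σ)) ∧
    (∀ (m n p q : ℕ) (X : SuperGeometry.Supermanifold.{u} m n)
      (Y : SuperGeometry.Supermanifold.{u} p q)
      (H : SuperGeometry.Morphism X.toSuperSpace Y.toSuperSpace) (x : X.body)
      (σ : X.BodyLift x) (τ : Y.BodyLift (H.base x)),
      (H.oddDifferential x).comp (X.iMap x σ) =
        (Y.iMap (H.base x) τ).comp (H.dualFibreMap x)) := by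
  refine ⟨fun m n X x => ⟨?_, SuperGeometry.Supermanifold.iMap_eq_iMap, fun σ =>
    ⟨SuperGeometry.Supermanifold.iMap_injective σ, SuperGeometry.Supermanifold.iMap_surjective σ⟩⟩,
    fun m n p q X Y H x σ τ => H.oddDifferential_comp_iMap x σ τ⟩
  obtain ⟨c, hc⟩ := X.exists_chart x
  exact ⟨SuperGeometry.Supermanifold.BodyLift.ofChart c hc⟩
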